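/- Let $p$ be a prime and let $\delta:\mathbb Z_p\to\mathbb Z_p$ be the Fermat quotient operator $\delta a=(a-a^p)/p$, with $i$-th iterate $\delta^i$ ($\delta^0 a=a$). A power series with coefficients in $\mathbb Z_p$ in finitely many variables is called restricted if its coefficients tend $p$-adically to $0$ as the total degree of the monomials tends to infinity. Let $m\ge 0$ be an integer and let $f:\mathbb Z_p\to\mathbb Z_p$ be analytic of level $m$, that is, for every $a\in\mathbb Z_p$ there is a restricted power series $F_a\in\mathbb Z_p[[x]]$ with $f(a+p^m u)=F_a(u)$ for all $u\in\mathbb Z_p$. Then $f$ is an arithmetic differential operator of order $m$, that is, there is a restricted power series $F\in\mathbb Z_p[[x_0,\dots,x_m]]$ with $f(a)=F(a,\delta a,\dots,\delta^m a)$ for all $a\in\mathbb Z_p$. More precisely, there is a unique restricted power series $F\in\mathbb Z_p[[x_0,\dots,x_m]]$ such that 1. every monomial that occurs in $F$ with nonzero coefficient has degree at most $p-1$ in each of the variables $x_0,\dots,x_{m-1}$ (with no condition on the degree in $x_m$), i.e. $F=\sum_{n\ge 0}\sum_{0\le\beta_0,\dots,\beta_{m-1}\le p-1}a_{\beta,n}\,x_0^{\beta_0}\cdots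 x_{m-1}^{\beta_{m-1}}x_m^{n}$; and 2. $f(a)=F(a,\delta a,\dots,\delta^m a)$ for all $a\in\mathbb Z_p$. -/

import Mathlib

noncomputable section

/-- By Fermat's little theorem in the residue field, `p` divides `a - a ^ p` in `ℤ_p`. -/
theorem PadicInt.natCast_dvd_sub_pow (p : ℕ) [Fact p.Prime] (a : ℤ_[p]) :
    (p : ℤ_[p]) ∣ a - a ^ p := by
  rw [← Ideal.mem_span_singleton, ← PadicInt.maximalIdeal_eq_span_p, ← PadicInt.ker_toZMod,
    RingHom.mem_ker, map_sub, map_pow, ZMod.pow_card, sub_self]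

/-- The Fermat quotient operator `δ a = (a - a ^ p) / p` on `ℤ_p`, the division being
performed in `ℚ_p`. -/
def fermatQuotient (p : ℕ) [Fact p.Prime] (a : ℤ_[p]) : ℤ_[p] :=
  ⟨((a : ℚ_[p]) - (a : ℚ_[p]) ^ p) / (p : ℚ_[p]), by
    obtain ⟨b, hb⟩ := PadicInt.natCast_dvd_sub_pow p a
    have hp : (p : ℚ_[p]) ≠ 0 := Nat.cast_ne_zero.mpr (Fact.out : p.Prime).ne_zero
    have h : (a : ℚ_[p]) - (a : ℚ_[p]) ^ p = (p : ℚ_[p]) * (b : ℚ_[p]) := by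
      exact_mod_cast congrArg (fun x : ℤ_[p] => (x : ℚ_[p])) hb
    rw [h, mul_div_cancel_left₀ _ hp]
    exact b.2⟩

/-- `f` is analytic of level `m`: for every `a` there is a restricted power series `G` in one
variable over `ℤ_p` (coefficients tending to `0`) with `f (a + p ^ m * u) = G u` for all `u`,
where `G u` is the sum of the series, its convergence being part of the assertion. -/
def IsAnalyticOfLevel (p : ℕ) [Fact p.Prime] (m : ℕ) (f : ℤ_[p] → ℤ_[p]) : Prop :=
  ∀ a : ℤ_[p], ∃ G : PowerSeries ℤ_[p], PowerSeries.IsRestricted 1 G ∧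
    ∀ u : ℤ_[p], HasSum (fun n : ℕ => PowerSeries.coeff n G * u ^ n)
      (f (a + (p : ℤ_[p]) ^ m * u))

/-- The power series `F` in `x_0, …, x_m` `δ`-represents `f`: for every `a` the series
`F (a, δ a, …, δ^m a)` converges, with sum `f a`. -/
def DeltaRepresents (p : ℕ) [Fact p.Prime] (m : ℕ) (F : MvPowerSeries (Fin (m + 1)) ℤ_[p])
    (f : ℤ_[p] → ℤ_[p]) : Prop :=
  ∀ a : ℤ_[p], HasSum
    (fun α : Fin (m + 1) →₀ ℕ =>
      MvPowerSeries.coeff α F * ∏ i : Fin (m + 1), ((fermatQuotient p)^[(i : ℕ)] a) ^ α i)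
    (f a)

/-- `f` is an arithmetic differential operator of order `m`: some restricted power series
(coefficients tending to `0`) in `x_0, …, x_m` over `ℤ_p` `δ`-represents `f`. -/
def IsArithmeticDiffOp (p : ℕ) [Fact p.Prime] (m : ℕ) (f : ℤ_[p] → ℤ_[p]) : Prop :=
  ∃ F : MvPowerSeries (Fin (m + 1)) ℤ_[p],
    MvPowerSeries.IsRestricted (fun _ => 1) F ∧ DeltaRepresents p m F f

/-- All monomials occurring in `F` have degree at most `p - 1` in each of the variables
`x_0, …, x_{m-1}`; the degree in `x_m` is unconstrained. -/
def HasCanonicalMonomials (p : ℕ) [Fact p.Prime] (m : ℕ)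
    (F : MvPowerSeries (Fin (m + 1)) ℤ_[p]) : Prop :=
  ∀ α : Fin (m + 1) →₀ ℕ, MvPowerSeries.coeff α F ≠ 0 → ∀ i : Fin m, α i.castSucc ≤ p - 1

end

open Filter Topology

noncomputable section

section Padic

variable {p : ℕ} [Fact p.Prime]

/-! Everything is done modulo `p` and then iterated. On a coset `b + p ^ m * u`, each `δ^i` with `i
≤ m` is a polynomial in `u`; modulo `p` it is constant for `i < m` and is `u + const` for `i = m`
(`nonempty_jetChart`). The residues of `a, …, δ^(m-1) a` determine the coset modulo `p ^ m`, and by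
counting every residue vector occurs.

Existence: modulo `p`, a restricted series in `u` is a polynomial in `x_m - δ^m b`. Gluing these
with the coset indicators, which have degree at most `p - 1` in `x_0, …, x_{m-1}`, gives `f = P + p
* g` with `g` again analytic on cosets. Iteration gives `F = ∑ p ^ k * P_k`.

Uniqueness: let a canonical `F` represent `0`. Modulo `p`, substituting the jet of each coset gives
the zero polynomial in `u`, so the reduction of `F` vanishes for all residues of the first `m`
variables and identically in `x_m`; the degree bound makes it zero. Hence `p` divides `F`, and `F /
p` satisfies the same hypotheses. -/

/-! ### Congruences for iterated Fermat quotients -/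

theorem natCast_mul_fermatQuotient (a : ℤ_[p]) :
    (p : ℤ_[p]) * fermatQuotient p a = a - a ^ p := by
  have hp : (p : ℚ_[p]) ≠ 0 := Nat.cast_ne_zero.mpr (Fact.out : p.Prime).ne_zero
  apply Subtype.ext
  rw [PadicInt.coe_mul, PadicInt.coe_natCast, PadicInt.coe_sub, PadicInt.coe_pow]
  exact mul_div_cancel₀ _ hp

theorem PadicInt.natCast_prime_ne_zero : (p : ℤ_[p]) ≠ 0 :=
  Nat.cast_ne_zero.mpr (Fact.out : p.Prime).ne_zero

theorem pow_succ_dvd_pow_sub_pow {R : Type*} [CommRing R] {q k : ℕ} {x y : R}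
    (hk : 1 ≤ k) (h : (q : R) ^ k ∣ x - y) : (q : R) ^ (k + 1) ∣ x ^ q - y ^ q := by
  have h1 : (q : R) ∣ x - y := (dvd_pow_self _ (by omega)).trans h
  rw [← Commute.geom_sum₂_mul (Commute.all x y), pow_succ']
  exact mul_dvd_mul (dvd_geom_sum₂_self h1) h

theorem pow_dvd_sub_of_iterate_fermatQuotient (m : ℕ) (a b : ℤ_[p])
    (h : ∀ i < m, (p : ℤ_[p]) ∣ (fermatQuotient p)^[i] a - (fermatQuotient p)^[i] b) :
    (p : ℤ_[p]) ^ m ∣ a - b := by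
  induction m generalizing a b with
  | zero => simp
  | succ m ih =>
    have h1 := ih (fermatQuotient p a) (fermatQuotient p b) fun i hi => by
      simpa using h (i + 1) (by omega)
    have h0 : (p : ℤ_[p]) ∣ a - b := by simpa using h 0 (by omega)
    have key : a - b = (a ^ p - b ^ p) +
        p * (fermatQuotient p a - fermatQuotient p b) := by
      rw [mul_sub, natCast_mul_fermatQuotient, natCast_mul_fermatQuotient]; ring
    -- Bootstrap in `key`: the `p`-th power gains one factor of `p`, and the other term is already
    -- divisible by `p ^ (m + 1)`.
    have : ∀ j ≤ m, (p : ℤ_[p]) ^ (j + 1) ∣ a - b := by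
      intro j
      induction j with
      | zero => intro _; simpa using h0
      | succ j ihj =>
        intro hj
        rw [key]
        refine dvd_add (pow_succ_dvd_pow_sub_pow (by omega) (ihj (by omega))) ?_
        rw [pow_succ']
        exact mul_dvd_mul_left _ ((pow_dvd_pow _ hj).trans h1)
    exact this m le_rfl

open Polynomial in
-- Applying `δ` costs one power of `p` in the increment; the `p`-th power term contributes only a
-- multiple of `p` to its leading factor.
theorem exists_polynomial_fermatQuotient (k : ℕ) (b : ℤ_[p]) (v : ℤ_[p][X]) :
    ∃ w : ℤ_[p][X], (p : ℤ_[p][X]) ∣ w - v ∧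
      ∀ u, fermatQuotient p (b + p ^ (k + 1) * v.eval u) =
        fermatQuotient p b + p ^ k * w.eval u := by
  obtain ⟨r, hr⟩ := pow_succ_dvd_pow_sub_pow (q := p) (k := k + 1) (x := C b + p ^ (k + 1) * v)
    (y := C b) (by omega) ⟨v, by ring⟩
  refine ⟨v - p * r, ⟨-r, by ring⟩, fun u => ?_⟩
  apply mul_left_cancel₀ (PadicInt.natCast_prime_ne_zero (p := p))
  have hu := congrArg (Polynomial.eval u) hr
  simp only [eval_sub, eval_pow, eval_add, eval_C, eval_mul, eval_natCast] at hu
  rw [mul_add, natCast_mul_fermatQuotient, natCast_mul_fermatQuotient]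
  simp only [eval_sub, eval_mul, eval_natCast]
  linear_combination -hu

open Polynomial in
theorem exists_polynomial_iterate_fermatQuotient (i k : ℕ) (b : ℤ_[p]) :
    ∃ w : ℤ_[p][X], (p : ℤ_[p][X]) ∣ w - X ∧
      ∀ u, (fermatQuotient p)^[i] (b + p ^ (k + i) * u) =
        (fermatQuotient p)^[i] b + p ^ k * w.eval u := by
  induction i generalizing k with
  | zero => exact ⟨X, by simp, by simp⟩
  | succ i ih =>
    obtain ⟨v, hv, hvu⟩ := ih (k + 1)
    obtain ⟨w, hw, hwu⟩ := exists_polynomial_fermatQuotient k ((fermatQuotient p)^[i] b) v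
    refine ⟨w, by simpa using dvd_add hw hv, fun u => ?_⟩
    rw [Function.iterate_succ_apply', Function.iterate_succ_apply', ← hwu, ← hvu]
    congr 4; ring

/-! ### Jets on cosets of `p ^ m` -/

/-- The point `(a, δ a, …, δ^m a)`. -/
def fermatJet (p : ℕ) [Fact p.Prime] (m : ℕ) (a : ℤ_[p]) : Fin (m + 1) → ℤ_[p] :=
  fun i => (fermatQuotient p)^[(i : ℕ)] a

theorem PadicInt.toZMod_eq_zero_iff (z : ℤ_[p]) :
    PadicInt.toZMod z = 0 ↔ (p : ℤ_[p]) ∣ z := by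
  rw [← RingHom.mem_ker, PadicInt.ker_toZMod, PadicInt.maximalIdeal_eq_span_p,
    Ideal.mem_span_singleton]

theorem PadicInt.toZMod_eq_iff (z w : ℤ_[p]) :
    PadicInt.toZMod z = PadicInt.toZMod w ↔ (p : ℤ_[p]) ∣ z - w := by
  rw [← toZMod_eq_zero_iff, map_sub, sub_eq_zero]

/-- Polynomials computing the jet of `b + p ^ m * u`, with their reductions modulo `p`. -/
structure JetChart (p : ℕ) [Fact p.Prime] (m : ℕ) (b : ℤ_[p]) where
  /-- The components of the jet, as polynomials in `u`. -/
  poly : Fin (m + 1) → Polynomial ℤ_[p]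
  eval_poly : ∀ u i, (poly i).eval u = fermatJet p m (b + p ^ m * u) i
  map_castSucc : ∀ i : Fin m, (poly i.castSucc).map (PadicInt.toZMod (p := p)) =
    Polynomial.C (PadicInt.toZMod (fermatJet p m b i.castSucc))
  map_last : (poly (Fin.last m)).map (PadicInt.toZMod (p := p)) =
    Polynomial.X + Polynomial.C (PadicInt.toZMod (fermatJet p m b (Fin.last m)))

open Polynomial in
theorem nonempty_jetChart (m : ℕ) (b : ℤ_[p]) : Nonempty (JetChart p m b) := by
  choose w hw hwu using fun i k => exists_polynomial_iterate_fermatQuotient (p := p) i k b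
  -- The factor `p ^ (m - i)` vanishes modulo `p` exactly when `i < m`.
  refine ⟨⟨fun i => C (fermatJet p m b i) + p ^ (m - i) * w i (m - i), ?_, ?_, ?_⟩⟩
  · intro u i
    have := hwu i (m - i) u
    rw [Nat.sub_add_cancel (by omega)] at this
    simp [fermatJet, this]
  · intro i
    have : m - (i : ℕ) ≠ 0 := by omega
    simp [this]
  · obtain ⟨r, hr⟩ := hw m 0
    have hw0 : w m 0 = X + (p : ℤ_[p][X]) * r := by linear_combination hr
    simp [hw0, add_comm]

namespace JetChart

variable {m : ℕ} {b : ℤ_[p]} (D : JetChart p m b)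

/-- Reduction modulo `p` of the substitution of a chart into polynomials. -/
def reduction : MvPolynomial (Fin (m + 1)) ℤ_[p] →+* Polynomial (ZMod p) :=
  (Polynomial.mapRingHom PadicInt.toZMod).comp (MvPolynomial.aeval D.poly).toRingHom

theorem reduction_apply (P : MvPolynomial (Fin (m + 1)) ℤ_[p]) :
    D.reduction P = (MvPolynomial.aeval D.poly P).map PadicInt.toZMod := rfl

theorem reduction_C (z : ℤ_[p]) :
    D.reduction (MvPolynomial.C z) = Polynomial.C (PadicInt.toZMod z) := by
  simp [reduction_apply]

theorem reduction_X_castSucc (i : Fin m) :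
    D.reduction (MvPolynomial.X i.castSucc) =
      Polynomial.C (PadicInt.toZMod (fermatJet p m b i.castSucc)) := by
  simp [reduction_apply, D.map_castSucc]

theorem reduction_X_last :
    D.reduction (MvPolynomial.X (Fin.last m)) =
      Polynomial.X + Polynomial.C (PadicInt.toZMod (fermatJet p m b (Fin.last m))) := by
  simp [reduction_apply, D.map_last]

theorem eval_aeval (P : MvPolynomial (Fin (m + 1)) ℤ_[p]) (u : ℤ_[p]) :
    (MvPolynomial.aeval D.poly P).eval u =
      MvPolynomial.eval (fermatJet p m (b + p ^ m * u)) P := by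
  rw [← Polynomial.coe_evalRingHom, MvPolynomial.aeval_def, MvPolynomial.hom_eval₂,
    MvPolynomial.eval, MvPolynomial.coe_eval₂Hom]
  congr 1
  · ext; simp
  · ext i; simp [D.eval_poly]

end JetChart

theorem eq_of_fermatJet_toZMod_eq {m b c : ℕ} (hb : b < p ^ m) (hc : c < p ^ m)
    (h : ∀ i : Fin m, PadicInt.toZMod (fermatJet p m (b : ℤ_[p]) i.castSucc) =
      PadicInt.toZMod (fermatJet p m (c : ℤ_[p]) i.castSucc)) : b = c := by
  have h1 : (p : ℤ_[p]) ^ m ∣ (b : ℤ_[p]) - c :=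
    pow_dvd_sub_of_iterate_fermatQuotient m _ _ fun i hi =>
      (PadicInt.toZMod_eq_iff _ _).1 (h ⟨i, hi⟩)
  have h2 : (p : ℤ_[p]) ^ m ∣ (((b : ℤ) - c : ℤ) : ℤ_[p]) := by push_cast; exact h1
  rw [PadicInt.pow_p_dvd_int_iff] at h2
  have := (Nat.modEq_iff_dvd (n := p ^ m) (a := c) (b := b)).2 (by exact_mod_cast h2)
  exact (Nat.ModEq.eq_of_lt_of_lt this hc hb).symm

theorem exists_fermatJet_toZMod (m : ℕ) (e : Fin m → ZMod p) :
    ∃ b : ℤ_[p], ∀ i : Fin m, PadicInt.toZMod (fermatJet p m b i.castSucc) = e i := by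
  let g : Fin (p ^ m) → (Fin m → ZMod p) := fun b i =>
    PadicInt.toZMod (fermatJet p m ((b : ℕ) : ℤ_[p]) i.castSucc)
  have hg : Function.Bijective g := by
    rw [Fintype.bijective_iff_injective_and_card]
    refine ⟨fun b c h => Fin.ext (eq_of_fermatJet_toZMod_eq b.2 c.2 fun i => congrFun h i), ?_⟩
    simp [ZMod.card]
  obtain ⟨b, hb⟩ := hg.2 e
  exact ⟨_, fun i => congrFun hb i⟩

theorem exists_eq_natCast_add_pow_mul (m : ℕ) (a : ℤ_[p]) :
    ∃ b < p ^ m, ∃ u : ℤ_[p], a = b + p ^ m * u := by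
  obtain ⟨u, hu⟩ := Ideal.mem_span_singleton.1 (PadicInt.appr_spec m a)
  exact ⟨a.appr m, PadicInt.appr_lt _ _, u, by linear_combination hu⟩

/-! ### Convergence as divisibility by powers of `p` -/

theorem norm_le_iff_pow_dvd (z : ℤ_[p]) (N : ℕ) :
    ‖z‖ ≤ (p : ℝ) ^ (-(N : ℤ)) ↔ (p : ℤ_[p]) ^ N ∣ z := by
  rw [PadicInt.norm_le_pow_iff_mem_span_pow, Ideal.mem_span_singleton]

theorem exists_pow_lt_of_pos {ε : ℝ} (hε : 0 < ε) : ∃ N : ℕ, (p : ℝ) ^ (-(N : ℤ)) < ε :=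
  PadicInt.exists_pow_neg_lt p hε

theorem tendsto_norm_cofinite_iff {ι : Type*} (c : ι → ℤ_[p]) :
    Tendsto (fun i => ‖c i‖) cofinite (𝓝 0) ↔ ∀ N : ℕ, {i | ¬ (p : ℤ_[p]) ^ N ∣ c i}.Finite := by
  have hp : (0 : ℝ) < p := by exact_mod_cast (Fact.out : p.Prime).pos
  constructor
  · intro h N
    have := (h.eventually (eventually_le_nhds (b := (p : ℝ) ^ (-(N : ℤ))) (by positivity)))
    simp only [norm_le_iff_pow_dvd, Filter.eventually_cofinite] at this
    exact this
  · intro h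
    rw [Metric.tendsto_nhds]
    intro ε hε
    obtain ⟨N, hN⟩ := exists_pow_lt_of_pos (p := p) hε
    have h1 : ∀ᶠ i in cofinite, (p : ℤ_[p]) ^ N ∣ c i := Filter.eventually_cofinite.2 (h N)
    filter_upwards [h1] with i hi
    simpa using ((norm_le_iff_pow_dvd _ _).2 hi).trans_lt hN

theorem pow_dvd_sub_sum_of_hasSum {ι : Type*} {g : ι → ℤ_[p]} {y : ℤ_[p]} (h : HasSum g y)
    {N : ℕ} {s : Finset ι} (hs : ∀ i ∉ s, (p : ℤ_[p]) ^ N ∣ g i) :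
    (p : ℤ_[p]) ^ N ∣ y - ∑ i ∈ s, g i := by
  classical
  have hp : (0 : ℝ) < p := by exact_mod_cast (Fact.out : p.Prime).pos
  have h1 := Metric.tendsto_nhds.1 h ((p : ℝ) ^ (-(N : ℤ))) (by positivity)
  obtain ⟨t, ht, hst⟩ := (h1.and (eventually_ge_atTop s)).exists
  have h2 : (p : ℤ_[p]) ^ N ∣ y - ∑ i ∈ t, g i := by
    rw [← norm_le_iff_pow_dvd, norm_sub_rev, ← dist_eq_norm]; exact ht.le
  rw [← Finset.sum_sdiff hst] at h2
  have h3 : (p : ℤ_[p]) ^ N ∣ ∑ i ∈ t \ s, g i :=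
    Finset.dvd_sum fun i hi => hs i (Finset.mem_sdiff.1 hi).2
  convert dvd_add h2 h3 using 1
  ring

theorem hasSum_of_pow_dvd_sub_sum {ι : Type*} {g : ι → ℤ_[p]} {y : ℤ_[p]}
    (h : ∀ N : ℕ, ∃ s : Finset ι, (∀ i ∉ s, (p : ℤ_[p]) ^ N ∣ g i) ∧
      (p : ℤ_[p]) ^ N ∣ y - ∑ i ∈ s, g i) : HasSum g y := by
  classical
  refine Metric.tendsto_nhds.2 fun ε hε => ?_
  obtain ⟨N, hN⟩ := exists_pow_lt_of_pos (p := p) hε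
  obtain ⟨s, hs, hsum⟩ := h N
  filter_upwards [eventually_ge_atTop s] with t hst
  refine lt_of_le_of_lt ?_ hN
  rw [dist_eq_norm, norm_sub_rev, norm_le_iff_pow_dvd, ← Finset.sum_sdiff hst]
  have h3 : (p : ℤ_[p]) ^ N ∣ ∑ i ∈ t \ s, g i :=
    Finset.dvd_sum fun i hi => hs i (Finset.mem_sdiff.1 hi).2
  convert dvd_sub hsum h3 using 1
  ring

theorem hasSum_natCast_prime_mul_iff {ι : Type*} {g : ι → ℤ_[p]} {y : ℤ_[p]} :
    HasSum (fun i => (p : ℤ_[p]) * g i) (p * y) ↔ HasSum g y := by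
  have h : Topology.IsInducing (AddMonoidHom.mulLeft (p : ℤ_[p])) :=
    ((continuous_const_mul (p : ℤ_[p])).isClosedEmbedding
      (mul_right_injective₀ PadicInt.natCast_prime_ne_zero)).isInducing
  exact h.hasSum_iff (g := AddMonoidHom.mulLeft (p : ℤ_[p])) g y

theorem PadicInt.pow_dvd_of_pow_succ_dvd_mul {N : ℕ} {z : ℤ_[p]}
    (h : (p : ℤ_[p]) ^ (N + 1) ∣ p * z) : (p : ℤ_[p]) ^ N ∣ z := by
  rw [pow_succ'] at h
  exact (mul_dvd_mul_iff_left PadicInt.natCast_prime_ne_zero).1 h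

theorem MvPowerSeries.isRestricted_one_iff {σ : Type*} (F : MvPowerSeries σ ℤ_[p]) :
    MvPowerSeries.IsRestricted (fun _ => 1) F ↔
      ∀ N : ℕ, {α | ¬ (p : ℤ_[p]) ^ N ∣ MvPowerSeries.coeff α F}.Finite := by
  rw [← tendsto_norm_cofinite_iff]
  simp [MvPowerSeries.IsRestricted, Finsupp.prod]

theorem PowerSeries.isRestricted_one_iff (G : PowerSeries ℤ_[p]) :
    PowerSeries.IsRestricted 1 G ↔
      ∀ N : ℕ, {n | ¬ (p : ℤ_[p]) ^ N ∣ PowerSeries.coeff n G}.Finite := by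
  rw [← tendsto_norm_cofinite_iff, PowerSeries.isRestricted_iff]
  simp

/-! ### Existence by successive approximation -/

/-- On each coset `b + p ^ m * ℤ_p`, with `0 ≤ b < p ^ m`, the function `f` is the sum of a
restricted power series in `u`. -/
def IsAnalyticOnCosets (p : ℕ) [Fact p.Prime] (m : ℕ) (f : ℤ_[p] → ℤ_[p]) : Prop :=
  ∀ b < p ^ m, ∃ G : ℕ → ℤ_[p], (∀ N : ℕ, {n | ¬ (p : ℤ_[p]) ^ N ∣ G n}.Finite) ∧
    ∀ u : ℤ_[p], HasSum (fun n : ℕ => G n * u ^ n) (f (b + (p : ℤ_[p]) ^ m * u))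

theorem IsAnalyticOfLevel.isAnalyticOnCosets {m : ℕ} {f : ℤ_[p] → ℤ_[p]}
    (hf : IsAnalyticOfLevel p m f) : IsAnalyticOnCosets p m f := fun b _ => by
  obtain ⟨G, hG, h⟩ := hf b
  exact ⟨_, (PowerSeries.isRestricted_one_iff G).1 hG, h⟩

/-- The polynomial `∏ (1 - (x_i - δ^i b) ^ (p - 1))` over `i < m`; modulo `p` it is the
indicator of the coset of `b`. -/
def cosetIndicator (m : ℕ) (b : ℤ_[p]) : MvPolynomial (Fin (m + 1)) ℤ_[p] :=
  ∏ i : Fin m, (1 - (MvPolynomial.X i.castSucc -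
    MvPolynomial.C (fermatJet p m b i.castSucc)) ^ (p - 1))

/-- The substitution of `x_m - δ^m b` into a polynomial in one variable. -/
def lastVariable (m : ℕ) (b : ℤ_[p]) (Q : Polynomial ℤ_[p]) :
    MvPolynomial (Fin (m + 1)) ℤ_[p] :=
  Polynomial.aeval (MvPolynomial.X (Fin.last m) -
    MvPolynomial.C (fermatJet p m b (Fin.last m))) Q

theorem degreeOf_cosetIndicator_le {m : ℕ} (b : ℤ_[p]) (i : Fin m) :
    (cosetIndicator m b).degreeOf i.castSucc ≤ p - 1 := by
  classical
  refine (MvPolynomial.degreeOf_prod_le _ _ _).trans ?_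
  have h : ∀ j : Fin m, MvPolynomial.degreeOf i.castSucc
      (1 - (MvPolynomial.X j.castSucc -
        MvPolynomial.C (fermatJet p m b j.castSucc)) ^ (p - 1)) ≤ if j = i then p - 1 else 0 := by
    intro j
    refine (MvPolynomial.degreeOf_sub_le _ _ _).trans ?_
    rw [MvPolynomial.degreeOf_one]
    refine max_le (Nat.zero_le _) ((MvPolynomial.degreeOf_pow_le _ _ _).trans ?_)
    have h1 : MvPolynomial.degreeOf i.castSucc ((MvPolynomial.X j.castSucc -
        MvPolynomial.C (fermatJet p m b j.castSucc) : MvPolynomial (Fin (m + 1)) ℤ_[p])) ≤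
        if j = i then 1 else 0 := by
      refine (MvPolynomial.degreeOf_sub_le _ _ _).trans ?_
      rw [MvPolynomial.degreeOf_C, MvPolynomial.degreeOf_X]
      simp only [Fin.castSucc_inj, eq_comm (a := i)]
      simp
    calc _ ≤ (p - 1) * _ := Nat.mul_le_mul_left _ h1
      _ = _ := by split_ifs <;> simp
  calc _ ≤ ∑ j : Fin m, if j = i then p - 1 else 0 := Finset.sum_le_sum fun j _ => h j
    _ = p - 1 := by simp

theorem degreeOf_lastVariable {m : ℕ} (b : ℤ_[p]) (Q : Polynomial ℤ_[p]) (i : Fin m) :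
    (lastVariable m b Q).degreeOf i.castSucc = 0 := by
  rw [← Nat.le_zero, lastVariable, Polynomial.aeval_eq_sum_range]
  refine (MvPolynomial.degreeOf_sum_le _ _ _).trans (Finset.sup_le fun n _ => ?_)
  rw [MvPolynomial.smul_eq_C_mul]
  refine (MvPolynomial.degreeOf_C_mul_le _ _ _).trans
    ((MvPolynomial.degreeOf_pow_le _ _ _).trans ?_)
  have : MvPolynomial.degreeOf i.castSucc ((MvPolynomial.X (Fin.last m) -
      MvPolynomial.C (fermatJet p m b (Fin.last m)) : MvPolynomial (Fin (m + 1)) ℤ_[p])) ≤ 0 := by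
    refine (MvPolynomial.degreeOf_sub_le _ _ _).trans ?_
    simp [MvPolynomial.degreeOf_X, MvPolynomial.degreeOf_C, (Fin.castSucc_lt_last i).ne]
  simpa using Nat.mul_le_mul_left n this

theorem JetChart.reduction_cosetIndicator_self {m : ℕ} {b : ℤ_[p]} (D : JetChart p m b) :
    D.reduction (cosetIndicator m b) = 1 := by
  have hp : p - 1 ≠ 0 := Nat.sub_ne_zero_of_lt (Fact.out : p.Prime).one_lt
  simp [cosetIndicator, map_prod, D.reduction_C, D.reduction_X_castSucc, hp]

theorem JetChart.reduction_cosetIndicator_of_ne {m : ℕ} {b c : ℕ} (hb : b < p ^ m)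
    (hc : c < p ^ m) (hbc : b ≠ c) (D : JetChart p m (c : ℤ_[p])) :
    D.reduction (cosetIndicator m b) = 0 := by
  have : ∃ i : Fin m, PadicInt.toZMod (fermatJet p m (b : ℤ_[p]) i.castSucc) ≠
      PadicInt.toZMod (fermatJet p m (c : ℤ_[p]) i.castSucc) := by
    by_contra! h
    exact hbc (eq_of_fermatJet_toZMod_eq hb hc h)
  obtain ⟨i, hi⟩ := this
  rw [cosetIndicator, map_prod]
  refine Finset.prod_eq_zero (Finset.mem_univ i) ?_
  rw [map_sub, map_pow, map_sub, D.reduction_C, D.reduction_X_castSucc, map_one,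
    ← Polynomial.C_sub, ← Polynomial.C_pow,
    ZMod.pow_card_sub_one_eq_one (sub_ne_zero.2 hi.symm), Polynomial.C_1, sub_self]

theorem JetChart.reduction_lastVariable {m : ℕ} {b : ℤ_[p]} (D : JetChart p m b)
    (Q : Polynomial ℤ_[p]) :
    D.reduction (lastVariable m b Q) = Q.map PadicInt.toZMod := by
  rw [lastVariable, Polynomial.aeval_def, Polynomial.hom_eval₂, map_sub, D.reduction_C,
    D.reduction_X_last, add_sub_cancel_right]
  have : D.reduction.comp (algebraMap ℤ_[p] (MvPolynomial (Fin (m + 1)) ℤ_[p])) =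
      Polynomial.C.comp PadicInt.toZMod := by
    ext z : 1
    simp [MvPolynomial.algebraMap_eq, D.reduction_C]
  rw [this]
  rfl

theorem exists_polynomial_toZMod_coeff_eq (G : ℕ → ℤ_[p])
    (hG : ∀ N : ℕ, {n | ¬ (p : ℤ_[p]) ^ N ∣ G n}.Finite) :
    ∃ Q : Polynomial ℤ_[p], ∀ n, PadicInt.toZMod (Q.coeff n) = PadicInt.toZMod (G n) := by
  classical
  refine ⟨∑ n ∈ (hG 1).toFinset, Polynomial.monomial n (G n), fun n => ?_⟩
  simp only [Polynomial.finsetSum_coeff, Polynomial.coeff_monomial, Finset.sum_ite_eq']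
  split_ifs with h
  · rfl
  · have : (p : ℤ_[p]) ∣ G n := by simpa using h
    rw [(PadicInt.toZMod_eq_zero_iff _).2 this, map_zero]

theorem Polynomial.hasSum_eval {R : Type*} [CommSemiring R] [TopologicalSpace R]
    (T : Polynomial R) (u : R) : HasSum (fun n => T.coeff n * u ^ n) (T.eval u) := by
  rw [Polynomial.eval_eq_sum_range]
  refine hasSum_sum_of_ne_finset_zero fun n hn => ?_
  rw [Polynomial.coeff_eq_zero_of_natDegree_lt (by simpa using hn), zero_mul]

/-- On each coset the series of `f` and the polynomial `P` of the jet agree modulo `p`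
coefficientwise, not merely in values, so the quotient `g` is again given by restricted series. -/
theorem IsAnalyticOnCosets.exists_approximation {m : ℕ} {f : ℤ_[p] → ℤ_[p]}
    (hf : IsAnalyticOnCosets p m f) :
    ∃ P : MvPolynomial (Fin (m + 1)) ℤ_[p], (∀ i : Fin m, P.degreeOf i.castSucc ≤ p - 1) ∧
      ∃ g, IsAnalyticOnCosets p m g ∧
        ∀ a, f a = MvPolynomial.eval (fermatJet p m a) P + p * g a := by
  choose! G hG hGf using hf
  have : ∀ b : ℕ, ∃ Q : Polynomial ℤ_[p], b < p ^ m →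
      ∀ n, PadicInt.toZMod (Q.coeff n) = PadicInt.toZMod (G b n) := fun b => by
    by_cases hb : b < p ^ m
    · obtain ⟨Q, hQ⟩ := exists_polynomial_toZMod_coeff_eq (G b) (hG b hb)
      exact ⟨Q, fun _ => hQ⟩
    · exact ⟨0, fun h => absurd h hb⟩
  choose Q hQ using this
  let P : MvPolynomial (Fin (m + 1)) ℤ_[p] :=
    ∑ b ∈ Finset.range (p ^ m), cosetIndicator m (b : ℤ_[p]) * lastVariable m b (Q b)
  have D : ∀ c : ℕ, JetChart p m (c : ℤ_[p]) := fun c => (nonempty_jetChart m _).some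
  have hred : ∀ c < p ^ m, (D c).reduction P = (Q c).map PadicInt.toZMod := fun c hc => by
    rw [map_sum, Finset.sum_eq_single_of_mem c (Finset.mem_range.2 hc), map_mul,
      JetChart.reduction_cosetIndicator_self, JetChart.reduction_lastVariable, one_mul]
    intro b hb hbc
    rw [map_mul, JetChart.reduction_cosetIndicator_of_ne (Finset.mem_range.1 hb) hc hbc, zero_mul]
  let T : ℕ → Polynomial ℤ_[p] := fun c => MvPolynomial.aeval (D c).poly P
  have hdvd : ∀ c < p ^ m, ∀ n, (p : ℤ_[p]) ∣ G c n - (T c).coeff n := fun c hc n => by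
    have := congrArg (fun q => Polynomial.coeff q n) (hred c hc)
    simp only [JetChart.reduction_apply, Polynomial.coeff_map] at this
    rw [← PadicInt.toZMod_eq_iff, ← hQ c hc n, ← this]
  have hsum : ∀ c < p ^ m, ∀ u : ℤ_[p], HasSum (fun n => (G c n - (T c).coeff n) * u ^ n)
      (f (c + p ^ m * u) - MvPolynomial.eval (fermatJet p m (c + p ^ m * u)) P) :=
    fun c hc u => by
      rw [← (D c).eval_aeval P u]
      simpa only [sub_mul] using (hGf c hc u).sub ((T c).hasSum_eval u)
  have hex : ∀ a, ∃ y, f a = MvPolynomial.eval (fermatJet p m a) P + p * y := fun a => by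
    obtain ⟨c, hc, u, rfl⟩ := exists_eq_natCast_add_pow_mul m a
    have h := pow_dvd_sub_sum_of_hasSum (hsum c hc u) (N := 1) (s := ∅) fun n _ => by
      rw [pow_one]; exact (hdvd c hc n).mul_right _
    rw [pow_one, Finset.sum_empty, sub_zero] at h
    obtain ⟨y, hy⟩ := h
    exact ⟨y, by linear_combination hy⟩
  choose g hg using hex
  refine ⟨P, fun i => ?_, g, fun c hc => ?_, hg⟩
  · refine (MvPolynomial.degreeOf_sum_le _ _ _).trans (Finset.sup_le fun b _ => ?_)
    refine (MvPolynomial.degreeOf_mul_le _ _ _).trans ?_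
    rw [degreeOf_lastVariable, add_zero]
    exact degreeOf_cosetIndicator_le _ i
  · choose H hH using hdvd c hc
    refine ⟨H, fun N => ?_, fun u => ?_⟩
    -- Off the support of `T c` one has `G c n = p * H n`, hence the exponent `N + 1`.
    · refine ((hG c hc (N + 1)).union (T c).support.finite_toSet).subset fun n hn => ?_
      by_contra hcon
      simp only [Set.mem_union, Set.mem_ofPred_eq, not_or, not_not, Finset.mem_coe,
        Polynomial.mem_support_iff] at hcon
      refine hn (PadicInt.pow_dvd_of_pow_succ_dvd_mul ?_)
      rw [← hH n, hcon.2, sub_zero]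
      exact hcon.1
    · rw [← hasSum_natCast_prime_mul_iff]
      convert hsum c hc u using 1
      · ext n
        rw [hH n, mul_assoc]
      · rw [hg (c + p ^ m * u)]
        ring

theorem IsAnalyticOnCosets.exists_expansion {m : ℕ} {f : ℤ_[p] → ℤ_[p]}
    (hf : IsAnalyticOnCosets p m f) :
    ∃ P : ℕ → MvPolynomial (Fin (m + 1)) ℤ_[p],
      (∀ k, ∀ i : Fin m, (P k).degreeOf i.castSucc ≤ p - 1) ∧
      ∀ N a, (p : ℤ_[p]) ^ N ∣ f a - MvPolynomial.eval (fermatJet p m a)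
        (∑ k ∈ Finset.range N, MvPolynomial.C ((p : ℤ_[p]) ^ k) * P k) := by
  choose P hP g hg hPg using fun h : {h // IsAnalyticOnCosets p m h} => h.2.exists_approximation
  let s : ℕ → {h // IsAnalyticOnCosets p m h} := fun n => (fun h => ⟨g h, hg h⟩)^[n] ⟨f, hf⟩
  have hs : ∀ n a, (s (n + 1)).1 a = g (s n) a := fun n a => by
    simp only [s, Function.iterate_succ_apply']
  refine ⟨fun k => P (s k), fun k => hP _, fun N a => ⟨(s N).1 a, ?_⟩⟩
  induction N with
  | zero => simp [s]
  | succ N ih =>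
    rw [Finset.sum_range_succ, map_add, ← sub_sub, ih, hPg (s N) a, hs, map_mul,
      MvPolynomial.eval_C]
    ring

theorem exists_hasSum_pow_mul (c : ℕ → ℤ_[p]) : ∃ y, HasSum (fun k => (p : ℤ_[p]) ^ k * c k) y := by
  have hp : 1 < p := (Fact.out : p.Prime).one_lt
  refine Summable.of_norm_bounded (g := fun k => ((p : ℝ)⁻¹) ^ k)
    (summable_geometric_of_lt_one (by positivity) (inv_lt_one_of_one_lt₀ (by exact_mod_cast hp)))
    fun k => ?_
  rw [norm_mul, norm_pow, PadicInt.norm_p]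
  exact mul_le_of_le_one_right (by positivity) (PadicInt.norm_le_one _)

/-- Sum `p ^ k * P k` coefficientwise: modulo `p ^ N` the result is the polynomial `R N`, which
yields both restrictedness and convergence to `f`. -/
theorem IsAnalyticOnCosets.exists_canonical {m : ℕ} {f : ℤ_[p] → ℤ_[p]}
    (hf : IsAnalyticOnCosets p m f) :
    ∃ F : MvPowerSeries (Fin (m + 1)) ℤ_[p],
      MvPowerSeries.IsRestricted (fun _ => 1) F ∧
        HasCanonicalMonomials p m F ∧ DeltaRepresents p m F f := by
  obtain ⟨P, hP, hPf⟩ := hf.exists_expansion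
  choose F hF using fun α : Fin (m + 1) →₀ ℕ =>
    exists_hasSum_pow_mul fun k => MvPolynomial.coeff α (P k)
  let R : ℕ → MvPolynomial (Fin (m + 1)) ℤ_[p] := fun N =>
    ∑ k ∈ Finset.range N, MvPolynomial.C ((p : ℤ_[p]) ^ k) * P k
  have hFR : ∀ N α, (p : ℤ_[p]) ^ N ∣ F α - MvPolynomial.coeff α (R N) := fun N α => by
    have := pow_dvd_sub_sum_of_hasSum (hF α) (N := N) (s := Finset.range N) fun k hk =>
      (pow_dvd_pow _ (by simpa using hk)).mul_right _
    simp only [R, MvPolynomial.coeff_sum, MvPolynomial.coeff_C_mul]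
    exact this
  have hnot : ∀ N α, α ∉ (R N).support → (p : ℤ_[p]) ^ N ∣ F α := fun N α hα => by
    simpa [MvPolynomial.notMem_support_iff.1 hα] using hFR N α
  refine ⟨F, (MvPowerSeries.isRestricted_one_iff _).2 fun N => ?_, fun α hα i => ?_, fun a => ?_⟩
  · refine (R N).support.finite_toSet.subset fun α hα => ?_
    by_contra h
    exact hα (hnot N α h)
  · have : ∃ k, MvPolynomial.coeff α (P k) ≠ 0 := by
      by_contra! h
      refine hα ((hF α).unique ?_)
      simp [h]
    obtain ⟨k, hk⟩ := this
    exact MvPolynomial.degreeOf_le_iff.1 (hP k i) α (MvPolynomial.mem_support_iff.2 hk)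
  · refine hasSum_of_pow_dvd_sub_sum fun N => ⟨(R N).support, fun α hα => ?_, ?_⟩
    · exact (hnot N α hα).mul_right _
    · have h := hPf N a
      change _ ∣ _ - MvPolynomial.eval _ (R N) at h
      rw [MvPolynomial.eval_eq'] at h
      have h2 : (p : ℤ_[p]) ^ N ∣ ∑ α ∈ (R N).support, (F α - MvPolynomial.coeff α (R N)) *
          ∏ i, fermatJet p m a i ^ α i :=
        Finset.dvd_sum fun α _ => (hFR N α).mul_right _
      simp only [sub_mul, Finset.sum_sub_distrib] at h2
      have h3 := dvd_sub h h2
      rw [sub_sub_sub_cancel_right] at h3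
      exact h3

/-! ### Uniqueness -/

/-- If `u` divides `p ^ M`, cancel it; otherwise `u` is congruent to `p ^ M` modulo `p ^ M`, and `T`
respects congruences. -/
theorem PadicInt.pow_dvd_eval_of_pow_dvd_mul_eval {M : ℕ} {T : Polynomial ℤ_[p]}
    (h : ∀ u, (p : ℤ_[p]) ^ (M + M) ∣ u * T.eval u) (u : ℤ_[p]) :
    (p : ℤ_[p]) ^ M ∣ T.eval u := by
  have hpM : (p : ℤ_[p]) ^ M ≠ 0 := pow_ne_zero _ natCast_prime_ne_zero
  have key : ∀ v : ℤ_[p], v ∣ (p : ℤ_[p]) ^ M → (p : ℤ_[p]) ^ M ∣ T.eval v := by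
    rintro v ⟨c, hc⟩
    have := (h v).mul_left c
    rw [pow_add, ← mul_assoc, mul_comm c v, ← hc] at this
    exact (mul_dvd_mul_iff_left hpM).1 this
  rcases ValuationRing.dvd_total u ((p : ℤ_[p]) ^ M) with hu | hu
  · exact key u hu
  · have h1 : u - (p : ℤ_[p]) ^ M ∣ T.eval u - T.eval ((p : ℤ_[p]) ^ M) :=
      Polynomial.sub_dvd_eval_sub _ _ _
    have h2 : (p : ℤ_[p]) ^ M ∣ u - (p : ℤ_[p]) ^ M := dvd_sub_self_right.2 hu
    simpa using dvd_add (h2.trans h1) (key _ dvd_rfl)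

/-- Small values force small coefficients, uniformly in the degree of `T`. Each removal of a
constant term and division by `u` halves the exponent, whence `2 ^ J`. -/
theorem PadicInt.pow_dvd_coeff_of_pow_dvd_eval (J N : ℕ) (T : Polynomial ℤ_[p])
    (h : ∀ u, (p : ℤ_[p]) ^ (N * 2 ^ J) ∣ T.eval u) : (p : ℤ_[p]) ^ N ∣ T.coeff J := by
  induction J generalizing T with
  | zero => simpa [Polynomial.coeff_zero_eq_eval_zero] using h 0
  | succ J ih =>
    rw [← Polynomial.coeff_divX]
    refine ih _ (pow_dvd_eval_of_pow_dvd_mul_eval fun u => ?_)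
    have h0 := dvd_sub (h u) (h 0)
    have hT := congrArg (Polynomial.eval u) (Polynomial.divX_mul_X_add T)
    simp only [Polynomial.eval_add, Polynomial.eval_mul, Polynomial.eval_X,
      Polynomial.eval_C, Polynomial.coeff_zero_eq_eval_zero] at hT
    convert h0 using 1
    · ring
    · rw [← hT]; ring

theorem map_toZMod_eq_zero_of_reduction_eq_zero {m : ℕ} {P : MvPolynomial (Fin (m + 1)) ℤ_[p]}
    (hP : ∀ i : Fin m, P.degreeOf i.castSucc ≤ p - 1)
    (h : ∀ (b : ℤ_[p]) (D : JetChart p m b), D.reduction P = 0) :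
    MvPolynomial.map (PadicInt.toZMod (p := p)) P = 0 := by
  classical
  have hp : 0 < p := (Fact.out : p.Prime).pos
  -- The degree in `x_m` may exceed `p - 1`, so the vanishing criterion needs more points than `ZMod
  -- p` has; the infinite domain of polynomials supplies them.
  let ψ : ℤ_[p] →+* Polynomial (ZMod p) := Polynomial.C.comp PadicInt.toZMod
  have hdeg : ∀ i, (MvPolynomial.map ψ P).degreeOf i ≤ P.degreeOf i := fun i =>
    MvPolynomial.degreeOf_le_iff.2 fun α hα =>
      MvPolynomial.degreeOf_le_iff.1 le_rfl α (MvPolynomial.support_map_subset _ _ hα)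
  suffices H : MvPolynomial.map ψ P = 0 by
    refine MvPolynomial.map_injective _ (Polynomial.C_injective (R := ZMod p)) ?_
    rw [MvPolynomial.map_map, map_zero]
    exact H
  obtain ⟨S, hS⟩ := Infinite.exists_subset_card_eq (Polynomial (ZMod p))
    (P.degreeOf (Fin.last m) + 1)
  refine MvPolynomial.eq_zero_of_eval_zero_at_prod_finset _
    (Fin.lastCases S fun _ => Finset.univ.image Polynomial.C) (fun i => ?_) fun x hx => ?_
  · refine (hdeg i).trans_lt ?_
    refine Fin.lastCases ?_ (fun i => ?_) i
    · rw [Fin.lastCases_last, hS]; omega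
    · rw [Fin.lastCases_castSucc, Finset.card_image_of_injective _ Polynomial.C_injective,
        Finset.card_univ, ZMod.card]
      have := hP i
      omega
  · have hx' : ∀ i : Fin m, ∃ e : ZMod p, Polynomial.C e = x i.castSucc := fun i => by
      simpa using hx i.castSucc
    choose e he using hx'
    obtain ⟨b, hb⟩ := exists_fermatJet_toZMod m e
    obtain ⟨D⟩ := nonempty_jetChart m b
    let q : Polynomial (ZMod p) :=
      x (Fin.last m) - Polynomial.C (PadicInt.toZMod (fermatJet p m b (Fin.last m)))
    -- Substituting `q` for `u` sends `x_m` to the prescribed value, turning the chart reduction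
    -- into evaluation at `x`.
    have hom : (Polynomial.compRingHom q).comp D.reduction =
        (MvPolynomial.eval x).comp (MvPolynomial.map ψ) := by
      refine MvPolynomial.ringHom_ext (fun z => ?_) fun i => ?_
      · simp [D.reduction_C, ψ]
      · refine Fin.lastCases ?_ (fun i => ?_) i
        · simp [D.reduction_X_last, q]
        · simp [D.reduction_X_castSucc, hb, ← he]
    have := RingHom.congr_fun hom P
    rw [RingHom.comp_apply, h b D, map_zero] at this
    exact this.symm

theorem dvd_coeff_of_deltaRepresents_zero {m : ℕ} {F : MvPowerSeries (Fin (m + 1)) ℤ_[p]}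
    (hF : MvPowerSeries.IsRestricted (fun _ => 1) F) (hc : HasCanonicalMonomials p m F)
    (h0 : DeltaRepresents p m F 0) (α : Fin (m + 1) →₀ ℕ) :
    (p : ℤ_[p]) ∣ MvPowerSeries.coeff α F := by
  classical
  rw [MvPowerSeries.isRestricted_one_iff] at hF
  let R : ℕ → MvPolynomial (Fin (m + 1)) ℤ_[p] := fun N =>
    ∑ β ∈ (hF N).toFinset, MvPolynomial.monomial β (MvPowerSeries.coeff β F)
  have hR : ∀ N β, MvPolynomial.coeff β (R N) =
      if (p : ℤ_[p]) ^ N ∣ MvPowerSeries.coeff β F then 0 else MvPowerSeries.coeff β F :=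
    fun N β => by
      simp only [R, MvPolynomial.coeff_sum, MvPolynomial.coeff_monomial, Finset.sum_ite_eq',
        Set.Finite.mem_toFinset, Set.mem_ofPred_eq]
      split_ifs <;> rfl
  have heval : ∀ N a, (p : ℤ_[p]) ^ N ∣ MvPolynomial.eval (fermatJet p m a) (R N) := fun N a => by
    have := pow_dvd_sub_sum_of_hasSum (h0 a) (N := N) (s := (hF N).toFinset) fun β hβ => by
      simp only [Set.Finite.mem_toFinset, Set.mem_ofPred_eq, not_not] at hβ
      exact hβ.mul_right _
    rw [Pi.zero_apply, zero_sub, dvd_neg] at this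
    simp only [R, map_sum, MvPolynomial.eval_monomial, Finsupp.prod_fintype _ _ fun _ => pow_zero _]
    exact this
  have hmap : ∀ N, 1 ≤ N → MvPolynomial.map (PadicInt.toZMod (p := p)) (R N) =
      MvPolynomial.map (PadicInt.toZMod (p := p)) (R 1) := fun N hN => by
    ext β
    rw [MvPolynomial.coeff_map, MvPolynomial.coeff_map, PadicInt.toZMod_eq_iff, hR, hR]
    have h1 : (p : ℤ_[p]) ∣ p ^ N := dvd_pow_self _ (by omega)
    rw [pow_one]
    split_ifs with h2 h3 h3
    · simp
    · exact absurd (h1.trans h2) h3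
    · simpa using h3
    · simp
  have hred : ∀ (b : ℤ_[p]) (D : JetChart p m b), D.reduction (R 1) = 0 := fun b D => by
    ext J
    have hfac : ∀ P, D.reduction P = MvPolynomial.eval₂ Polynomial.C
        (fun i => (D.poly i).map PadicInt.toZMod) (MvPolynomial.map PadicInt.toZMod P) := fun P => by
      have hom : D.reduction = (MvPolynomial.eval₂Hom Polynomial.C
          (fun i => (D.poly i).map PadicInt.toZMod)).comp (MvPolynomial.map PadicInt.toZMod) :=
        MvPolynomial.ringHom_ext (fun z => by simp [D.reduction_C])
          fun i => by simp [D.reduction_apply]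
      exact RingHom.congr_fun hom P
    -- Values divisible by `p` alone would not suffice (consider `u ^ p - u`). All truncations agree
    -- modulo `p`, so for the `J`-th coefficient pass to one whose values are divisible by `p ^ (2 ^
    -- J)`.
    rw [hfac, ← hmap (1 * 2 ^ J) (by rw [one_mul]; exact Nat.one_le_two_pow), ← hfac,
      D.reduction_apply, Polynomial.coeff_map, Polynomial.coeff_zero,
      PadicInt.toZMod_eq_zero_iff, ← pow_one (p : ℤ_[p])]
    refine PadicInt.pow_dvd_coeff_of_pow_dvd_eval J 1 _ fun u => ?_
    rw [D.eval_aeval]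
    exact heval _ _
  have hdeg : ∀ i : Fin m, (R 1).degreeOf i.castSucc ≤ p - 1 := fun i =>
    MvPolynomial.degreeOf_le_iff.2 fun β hβ => hc β (fun h => by
      rw [MvPolynomial.mem_support_iff, hR, h, ite_self] at hβ
      exact hβ rfl) i
  have hzero := congrArg (MvPolynomial.coeff α) (map_toZMod_eq_zero_of_reduction_eq_zero hdeg hred)
  rw [MvPolynomial.coeff_map, MvPolynomial.coeff_zero, PadicInt.toZMod_eq_zero_iff, hR,
    pow_one] at hzero
  by_contra h
  rw [if_neg h] at hzero
  exact h hzero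

theorem pow_dvd_coeff_of_deltaRepresents_zero {m : ℕ} (N : ℕ)
    {F : MvPowerSeries (Fin (m + 1)) ℤ_[p]}
    (hF : MvPowerSeries.IsRestricted (fun _ => 1) F) (hc : HasCanonicalMonomials p m F)
    (h0 : DeltaRepresents p m F 0) (α : Fin (m + 1) →₀ ℕ) :
    (p : ℤ_[p]) ^ N ∣ MvPowerSeries.coeff α F := by
  induction N generalizing F with
  | zero => simp
  | succ N ih =>
    choose E hE using dvd_coeff_of_deltaRepresents_zero hF hc h0
    have hE' : ∀ β, MvPowerSeries.coeff β F = p * MvPowerSeries.coeff β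
      (show MvPowerSeries (Fin (m + 1)) ℤ_[p] from E) := hE
    rw [hE' α, pow_succ']
    refine mul_dvd_mul_left _ (ih ?_ (fun β hβ => hc β ?_) fun a => ?_)
    · rw [MvPowerSeries.isRestricted_one_iff] at hF ⊢
      refine fun K => (hF (K + 1)).subset fun β hβ h => hβ ?_
      rw [hE' β] at h
      exact PadicInt.pow_dvd_of_pow_succ_dvd_mul h
    · rw [hE' β]
      exact mul_ne_zero PadicInt.natCast_prime_ne_zero hβ
    · rw [← hasSum_natCast_prime_mul_iff]
      have := h0 a
      simp only [hE', mul_assoc] at this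
      simpa using this

theorem PadicInt.eq_zero_of_forall_pow_dvd {z : ℤ_[p]} (h : ∀ N : ℕ, (p : ℤ_[p]) ^ N ∣ z) :
    z = 0 := by
  by_contra hz
  obtain ⟨N, hN⟩ := exists_pow_lt_of_pos (p := p) (norm_pos_iff.2 hz)
  exact absurd ((norm_le_iff_pow_dvd z N).2 (h N)) (not_le.2 hN)

theorem eq_of_deltaRepresents {m : ℕ} {f : ℤ_[p] → ℤ_[p]}
    {F G : MvPowerSeries (Fin (m + 1)) ℤ_[p]}
    (hF : MvPowerSeries.IsRestricted (fun _ => 1) F) (hFc : HasCanonicalMonomials p m F)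
    (hFf : DeltaRepresents p m F f)
    (hG : MvPowerSeries.IsRestricted (fun _ => 1) G) (hGc : HasCanonicalMonomials p m G)
    (hGf : DeltaRepresents p m G f) : F = G := by
  rw [← sub_eq_zero]
  ext α
  refine PadicInt.eq_zero_of_forall_pow_dvd fun N => ?_
  refine pow_dvd_coeff_of_deltaRepresents_zero N ?_ (fun β hβ i => ?_) (fun a => ?_) α
  · rw [sub_eq_add_neg]
    exact MvPowerSeries.isRestricted.add _ hF (MvPowerSeries.isRestricted.neg _ hG)
  · by_cases h : MvPowerSeries.coeff β F = 0
    · refine hGc β (fun h' => hβ ?_) i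
      rw [map_sub, h, h', sub_zero]
    · exact hFc β h i
  · simpa [sub_mul] using (hFf a).sub (hGf a)

end Padic

end

theorem theorem5p1 (p : ℕ) [Fact p.Prime] (m : ℕ) (f : ℤ_[p] → ℤ_[p])
    (hf : IsAnalyticOfLevel p m f) :
    IsArithmeticDiffOp p m f ∧
      ∃! F : MvPowerSeries (Fin (m + 1)) ℤ_[p],
        MvPowerSeries.IsRestricted (fun _ => 1) F ∧
          HasCanonicalMonomials p m F ∧ DeltaRepresents p m F f := by
  obtain ⟨F, hF, hFc, hFf⟩ := hf.isAnalyticOnCosets.exists_canonical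
  exact ⟨⟨F, hF, hFf⟩, F, ⟨hF, hFc, hFf⟩, fun G ⟨hG, hGc, hGf⟩ =>
    eq_of_deltaRepresents hG hGc hGf hF hFc hFf⟩
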